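/- A (string-based) multiway system $M=(R,s_{\mathrm{init}},\Sigma)$ consists of a finite alphabet $\Sigma$, a finite set $R$ of string replacement rules $r\to t$ with $r,t\in\Sigma^*$, and an initial string $s_{\mathrm{init}}\in\Sigma^*$. Its states graph has an edge from $urv$ to $utv$ for every rule $r\to t$ in $R$ and all $u,v\in\Sigma^*$. For $n\in\mathbb{N}_+$ the growth function $g_M(n)$ is the number of states of generation $n$, i.e. of strings whose shortest path from $s_{\mathrm{init}}$ in the states graph has length $n-1$ (generation $1$ is $\{s_{\mathrm{init}}\}$). $M$ is unbounded if $g_M$ is nowhere zero and unbounded. For a sequence $c$ on $\mathbb{N}_+$ let $L(c):\mathbb{R}_{\ge 0}\to\mathbb{R}_{\ge 0}$ be the polygonal chain starting at $(0,0)$ and passing through the points $(n,c_n)$, $n\in\mathbb{N}_+$. Put $\overline{c}_n=\max\{c_k\mid k\le n\}$ and $\underline{c}_n=\max(\{c_k\mid k\le n,\ c_l\ge c_k\text{ for all }l\ge k\}\cup\{1\})$. A pair of continuous functions $a,b:\mathbb{R}_{\ge 0}\to\mathbb{R}_{\ge 0}$ is a pair of tight bounds of $c$ if $a\in\Theta(L(\overline{c}))$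 and $b\in\Theta(L(\underline{c}))$. An unbounded system $M$ has growth rate $(a,b)$ if $(a,b)$ is a pair of tight bounds of $g_M$; it is regular if $a\in\Theta(b)$ for all such pairs. An asymptotic inverse of $f:\mathbb{N}\to\mathbb{N}$ is a bijection $h:\mathbb{R}_{\ge 0}\to\mathbb{R}_{\ge 0}$ whose inverse function is in $\Theta(L(f|_{\mathbb{N}_+}))$. Theorem. Let $f:\mathbb{N}\to\mathbb{N}$ be a computable function with $f\in\omega(1)$. Then there is an unbounded regular multiway system with growth rate $(a,b)$, where $a,b$ are continuous bijections of $\mathbb{R}_{\ge 0}$, such that $a,b\in\mathcal{O}(f^{-1})$ for an asymptotic inverse $f^{-1}$ of $f$. Moreover, for the same system, $a,b\in\mathcal{O}(h)$ for every asymptotic inverse $h$ of $f$ with $h(x)\to\infty$ as $x\to\infty$. -/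

import Mathlib

open Filter Asymptotics
open scoped NNReal

/-- A string-based multiway system: a finite alphabet, a finite set of string replacement rules
`r → t` over it, and an initial string. -/
structure MultiwaySystem where
  Alphabet : Type
  [finite_alphabet : Finite Alphabet]
  rules : Finset (List Alphabet × List Alphabet)
  init : List Alphabet

namespace MultiwaySystem

/-- One edge of the states graph: a single occurrence of the left-hand side of a rule is replaced
by its right-hand side. -/
def Step (M : MultiwaySystem) (s t : List M.Alphabet) : Prop :=
  ∃ p ∈ M.rules, ∃ u v : List M.Alphabet, s = u ++ p.1 ++ v ∧ t = u ++ p.2 ++ v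

/-- `M.Path d s`: the states graph has a path of length `d` from the initial string to `s`. -/
inductive Path (M : MultiwaySystem) : ℕ → List M.Alphabet → Prop
  | init : Path M 0 M.init
  | step {d : ℕ} {s t : List M.Alphabet} : Path M d s → M.Step s t → Path M (d + 1) t

/-- The states whose shortest path from the initial string has length `d`. -/
def layer (M : MultiwaySystem) (d : ℕ) : Set (List M.Alphabet) :=
  {s | M.Path d s ∧ ∀ e < d, ¬ M.Path e s}

/-- The state-set of generation `n = 1, 2, 3, …`; generation `1` consists of the initial string
alone, so generation `n` consists of the states at distance `n - 1`. -/
def stateSet (M : MultiwaySystem) (n : ℕ+) : Set (List M.Alphabet) :=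
  M.layer n.natPred

theorem finite_setOf_step (M : MultiwaySystem) (s : List M.Alphabet) : {t | M.Step s t}.Finite := by
  have h : {t | M.Step s t} ⊆ ⋃ p ∈ (M.rules : Set (List M.Alphabet × List M.Alphabet)),
      (fun ij : ℕ × ℕ => s.take ij.1 ++ p.2 ++ s.drop ij.2) ''
        (Set.Iic s.length ×ˢ Set.Iic s.length) := by
    rintro t ⟨p, hp, u, v, hs, ht⟩
    simp only [Set.mem_iUnion]
    refine ⟨p, hp, ⟨u.length, (u ++ p.1).length⟩, ?_, ?_⟩
    · subst hs
      constructor <;> simp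
    · subst hs ht
      simp only [List.drop_left]
      simp
  exact (M.rules.finite_toSet.biUnion fun p _ =>
    ((Set.finite_Iic _).prod (Set.finite_Iic _)).image _).subset h

/-- Every state-set is finite, so that `Set.ncard` below is its number of elements. -/
theorem finite_stateSet (M : MultiwaySystem) (n : ℕ+) : (M.stateSet n).Finite := by
  have h : ∀ d, {s | M.Path d s}.Finite := by
    intro d
    induction d with
    | zero =>
      refine (Set.finite_singleton M.init).subset ?_
      rintro s hs
      cases hs
      rfl
    | succ d ih =>
      refine (ih.biUnion fun s _ => M.finite_setOf_step s).subset ?_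
      rintro t ht
      cases ht with
      | step h1 h2 => exact Set.mem_biUnion h1 h2
  exact (h _).subset fun s hs => hs.1

/-- The growth function `g_M`. -/
noncomputable def growth (M : MultiwaySystem) (n : ℕ+) : ℕ :=
  (M.stateSet n).ncard

def IsFinite (M : MultiwaySystem) : Prop := ∃ n, M.growth n = 0

def IsBounded (M : MultiwaySystem) : Prop := (∃ b : ℕ, ∀ n, M.growth n ≤ b) ∧ ¬ M.IsFinite

def IsUnbounded (M : MultiwaySystem) : Prop := ¬ M.IsFinite ∧ ¬ M.IsBounded

end MultiwaySystem

/-- The linear interpolation of `g` over the positive integers: the polygonal chain starting at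
`(0, 0)` and passing through the points `(n, g n)`, `n = 1, 2, 3, …`. -/
noncomputable def linearInterpolation (g : ℕ+ → ℕ) (x : ℝ≥0) : ℝ :=
  let node : ℕ → ℝ := fun n => if h : 0 < n then (g ⟨n, h⟩ : ℝ) else 0
  node ⌊x⌋₊ + ((x : ℝ) - ⌊x⌋₊) * (node (⌊x⌋₊ + 1) - node ⌊x⌋₊)

/-- `a ∈ O(b)` for functions on the nonnegative reals. -/
def InBigO (a b : ℝ≥0 → ℝ≥0) : Prop :=
  (fun x => (a x : ℝ)) =O[atTop] (fun x => (b x : ℝ))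

/-- The tightest monotonically increasing upper bound of a sequence,
`n ↦ max {a_k | k ≤ n}`. -/
noncomputable def upperSeq (a : ℕ+ → ℕ) (n : ℕ+) : ℕ :=
  sSup {m | ∃ k ≤ n, m = a k}

/-- The tightest monotonically increasing lower bound of a sequence,
`n ↦ max ({a_k | k ≤ n and a_l ≥ a_k for all l ≥ k} ∪ {1})`. -/
noncomputable def lowerSeq (a : ℕ+ → ℕ) (n : ℕ+) : ℕ :=
  sSup ({m | ∃ k ≤ n, (∀ l ≥ k, a l ≥ a k) ∧ m = a k} ∪ {1})

/-- `(f, g)` is a pair of tight bounds of the sequence `a`. -/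
def IsTightBounds (a : ℕ+ → ℕ) (f g : ℝ≥0 → ℝ≥0) : Prop :=
  Continuous f ∧ Continuous g ∧
    (fun x => (f x : ℝ)) =Θ[atTop] linearInterpolation (upperSeq a) ∧
    (fun x => (g x : ℝ)) =Θ[atTop] linearInterpolation (lowerSeq a)

/-- An unbounded multiway system is regular if its tight bounds are asymptotically equal. -/
def MultiwaySystem.IsRegular (M : MultiwaySystem) : Prop :=
  M.IsUnbounded ∧ ∀ f g : ℝ≥0 → ℝ≥0, IsTightBounds M.growth f g →
    (fun x => (f x : ℝ)) =Θ[atTop] (fun x => (g x : ℝ))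

/-- `h` is an asymptotic inverse of `f`: it is invertible, and its inverse `h⁻¹` is in `Θ(f)`
(where `f` is extended to the nonnegative reals by linear interpolation). -/
def IsAsymptoticInverse (f : ℕ → ℕ) (h : ℝ≥0 → ℝ≥0) : Prop :=
  ∃ k : ℝ≥0 → ℝ≥0, Function.LeftInverse k h ∧ Function.RightInverse k h ∧
    (fun x => (k x : ℝ)) =Θ[atTop] linearInterpolation (fun n => f n)

/-!
The growth of the system constructed here is as slow as one likes, by the following mechanism. A
single-tape Turing machine computing a fast growing function `φ` is simulated by string rewriting,
one head letter in the word marking the position where it can be rewritten; whenever the machine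
halts, it is restarted on its own output, so that it computes `φ 0`, `φ (φ 0)`, … without end. At
each restart there is a second possibility: the head letter may also be replaced by a letter `mark`,
after which the word does nothing but collect one counting letter per step. No state is ever
reached twice, so generation `n` consists of one state on the main path and one state for each
restart that has happened before (`MultiwaySystem.growth_eq_of_branching`). The growth function is
therefore nondecreasing, which makes the system regular, and it is unbounded since every evaluation
terminates.

A rewriting step lengthens the word of a running machine by at most one letter, so the `k`-th
restart cannot happen before the word is long enough to contain the binary digits of the `k`-th
iterate of `φ` at `0`. With `φ x = 2 ^ e (x + 1)` this forces at least `e k - s` steps, for a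
constant `s`, before the `k`-th restart (`MultiwaySystem.exists_slow_growth`). Taking for `e` a
function larger than `k * ∑ i ≤ k, f i` makes the growth slower than every asymptotic inverse of `f`
that tends to infinity (`inBigO_strictInterpolation`), and such an inverse exists
(`exists_isAsymptoticInverse`).

The machine comes from the compilation of partial recursive functions to `Turing.TM0` machines in
Mathlib; it matters that its output format agrees with its input format
(`Turing.exists_restartable_machine`).
-/

/-! ### Turing machines that can be restarted on their own output -/

namespace Turing

open PartrecToTM2

theorem PartrecToTM2.lt_two_pow_length_trPosNum :
    ∀ p : PosNum, (p : ℕ) < 2 ^ (trPosNum p).length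
  | .one => by simp [trPosNum]
  | .bit0 p => by
    have := lt_two_pow_length_trPosNum p
    simp only [PosNum.cast_bit0, trPosNum, List.length_cons, pow_succ]
    omega
  | .bit1 p => by
    have := lt_two_pow_length_trPosNum p
    simp only [PosNum.cast_bit1, trPosNum, List.length_cons, pow_succ]
    omega

theorem PartrecToTM2.lt_two_pow_length_trNat (n : ℕ) : n < 2 ^ (trNat n).length := by
  have h : ∀ m : Num, (m : ℕ) < 2 ^ (trNum m).length
    | .zero => by simp [trNum]
    | .pos p => by simpa [trNum] using lt_two_pow_length_trPosNum p
  simpa [trNat] using h n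

instance : Finite K' :=
  Finite.of_surjective (fun i : Fin 4 => ![K'.main, K'.rev, K'.aux, K'.stack] i) fun k => by
    cases k
    exacts [⟨0, rfl⟩, ⟨1, rfl⟩, ⟨2, rfl⟩, ⟨3, rfl⟩]

/-- The tape `R` holds the natural number `n`, in the format in which the single-tape simulation
of `PartrecToTM2` reads its input and leaves its output. -/
def TapeHolds (n : ℕ) (R : ListBlank (TM2to1.Γ' K' fun _ => PartrecToTM2.Γ')) : Prop :=
  ∃ L : ListBlank (K' → Option PartrecToTM2.Γ'), R = TM2to1.addBottom L ∧
    ∀ k, L.map (proj k) = ListBlank.mk (((K'.elim (trList [n]) [] [] []) k).map some).reverse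

theorem exists_tapeHolds (n : ℕ) : ∃ R, TapeHolds n R := by
  have h : K'.elim (trList [n]) [] [] [] =
      Function.update (fun _ => []) K'.main (trList [n]) := by
    funext k
    cases k <;> rfl
  obtain ⟨c, hc⟩ : ∃ c, TM2to1.TrCfg (TM2.init (Γ := fun _ : K' => PartrecToTM2.Γ')
      (Λ := PartrecToTM2.Λ') (σ := Option PartrecToTM2.Γ') K'.main (trList [n])) c :=
    ⟨_, TM2to1.trCfg_init _ _⟩
  obtain ⟨L, hL⟩ := hc
  exact ⟨_, L, rfl, fun k => by rw [h]; exact hL k⟩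

/-- A list representing a tape that holds `n` is at least as long as the binary expansion of `n`,
as that expansion is written on nonblank cells. -/
theorem TapeHolds.lt_two_pow_length {n : ℕ} {l} (h : TapeHolds n (ListBlank.mk l)) :
    n < 2 ^ l.length := by
  obtain ⟨L, hR, hL⟩ := h
  refine (lt_two_pow_length_trNat n).trans_le (Nat.pow_le_pow_right (by norm_num) ?_)
  by_contra! hlt
  have h1 : L.nth l.length K'.main = none := by
    rw [← TM2to1.addBottom_nth_snd L, ← hR, ListBlank.nth_mk, List.getI_eq_default _ le_rfl]
    rfl
  rw [TM2to1.stk_nth_val (S := K'.elim (trList [n]) [] [] [] K'.main) _ (hL K'.main)] at h1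
  simp at h1
  omega

/-- Every computable function is computed by a finite single-tape machine that halts with its
output in the format of its input, so that it can be restarted on its own output. -/
theorem exists_restartable_machine {φ : ℕ → ℕ} (hφ : Computable φ) :
    ∃ (Γ Q : Type) (_ : Inhabited Γ) (_ : Inhabited Q) (_ : Finite Γ) (_ : Finite Q)
      (M : TM0.Machine Γ Q) (E : ℕ → ListBlank Γ → Prop),
      (∃ R, E 0 R) ∧
      (∀ n R, E n R → ∃ q R', E (φ n) R' ∧
        StateTransition.Reaches (TM0.step M) ⟨default, Tape.mk' ∅ R⟩ ⟨q, Tape.mk' ∅ R'⟩ ∧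
        M q R'.head = none) ∧
      ∀ n l, E n (ListBlank.mk l) → n < 2 ^ l.length := by
  classical
  obtain ⟨c, hc⟩ := ToPartrec.Code.exists_code (Nat.Partrec'.part_iff₁.2 hφ)
  have : Fintype K' := Fintype.ofFinite _
  -- The default label is the one at which the machines start.
  let i : Inhabited PartrecToTM2.Λ' := ⟨trNormal c Cont'.halt⟩
  let M₁ := TM2to1.tr PartrecToTM2.tr
  let M₀ := TM1to0.tr M₁
  have hS := TM1to0.tr_supports M₁ (TM2to1.tr_supports PartrecToTM2.tr
    (PartrecToTM2.tr_supports c Cont'.halt))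
  generalize TM1to0.trStmts M₁ _ = S at hS
  -- Only the finitely many states in `S` are kept.
  let j : Inhabited S := ⟨⟨default, hS.1⟩⟩
  let g : TM1to0.Λ' M₁ → S := fun q => if h : q ∈ S then ⟨q, h⟩ else default
  have hg : ∀ (q : TM1to0.Λ' M₁) (h : q ∈ S), g q = ⟨q, h⟩ := fun q h => dif_pos h
  let f : PointedMap (TM2to1.Γ' K' fun _ => PartrecToTM2.Γ')
    (TM2to1.Γ' K' fun _ => PartrecToTM2.Γ') := ⟨id, rfl⟩
  let N : TM0.Machine (TM2to1.Γ' K' fun _ => PartrecToTM2.Γ') S :=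
    M₀.map f f g Subtype.val
  refine ⟨_, S, inferInstance, j, Finite.of_fintype _, inferInstance, N, TapeHolds,
    exists_tapeHolds 0, ?_, fun n l h => h.lt_two_pow_length⟩
  rintro n _ ⟨L, rfl, hL⟩
  have h2 : PartrecToTM2.halt [φ n] ∈
      StateTransition.eval (TM2.step PartrecToTM2.tr) (PartrecToTM2.init c [n]) := by
    have := hc (n ::ᵥ List.Vector.nil)
    rw [PartrecToTM2.tr_eval]
    simp [show c.eval [n] = _ from this]
    exact Part.mem_some _
  obtain ⟨c₁, hc₁, h3⟩ := StateTransition.tr_eval (TM2to1.tr_respects PartrecToTM2.tr)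
    (TM2to1.TrCfg.mk L hL) h2
  obtain ⟨_, rfl, h4⟩ := StateTransition.tr_eval (TM1to0.tr_respects M₁) rfl h3
  obtain ⟨_, ⟨-, rfl⟩, h5⟩ := StateTransition.tr_eval
    (TM0.Machine.map_respects M₀ f f ⟨g, hg _ hS.1⟩ Subtype.val hS (fun _ => rfl)
      fun q hq => congrArg Subtype.val (hg q hq))
    (And.intro hS.1 rfl) h4
  obtain ⟨L', hL'⟩ := hc₁
  obtain ⟨h6, h7⟩ := StateTransition.mem_eval.1 h5
  have hmap : ∀ R : ListBlank (TM2to1.Γ' K' fun _ => PartrecToTM2.Γ'),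
      (Tape.mk' ∅ R).map f = Tape.mk' ∅ R := by
    intro R
    have : ∀ R : ListBlank (TM2to1.Γ' K' fun _ => PartrecToTM2.Γ'), R.map f = R := fun R =>
      R.induction_on fun l => by rw [ListBlank.map_mk]; exact congrArg _ (List.map_id l)
    rw [Tape.map_mk', this, this]
  simp only [TM1to0.trCfg, TM0.Cfg.map, hmap] at h6 h7
  have hd : g ((some (TM2to1.Λ'.normal (trNormal c Cont'.halt))).map M₁, none) = default :=
    hg _ hS.1
  simp only [Option.map_some] at h6 hd
  rw [hd] at h6
  exact ⟨_, _, ⟨L', rfl, hL'⟩, h6, by simpa [TM0.step] using h7⟩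

end Turing

/-! ### Rewriting of words with a single head letter -/

section Window

variable {A : Type}

/-- The rules that replace a window of three letters by one of the words allowed for it. -/
noncomputable def windowRules [Finite A] (δ : A → A → A → List (List A)) :
    Finset (List A × List A) :=
  Set.Finite.toFinset (s := ⋃ w : A × A × A,
    (fun r => ([w.1, w.2.1, w.2.2], r)) '' {r | r ∈ δ w.1 w.2.1 w.2.2})
    (Set.finite_iUnion fun _ => (List.finite_toSet _).image _)

theorem mem_windowRules [Finite A] {δ : A → A → A → List (List A)} {p : List A × List A} :
    p ∈ windowRules δ ↔ ∃ x y z, ∃ r ∈ δ x y z, p = ([x, y, z], r) := by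
  simp only [windowRules, Set.Finite.mem_toFinset, Set.mem_iUnion, Prod.exists, Set.mem_image,
    Set.mem_ofPred_eq, eq_comm (a := p)]

/-- The multiway system of the window rules `δ`. -/
noncomputable def windowSystem [Finite A] (δ : A → A → A → List (List A)) (w : List A) :
    MultiwaySystem where
  Alphabet := A
  rules := windowRules δ
  init := w

/-- If every window has a head in its middle, then a word with exactly one head can only be
rewritten around that head. -/
theorem windowSystem_step_iff [Finite A] {δ : A → A → A → List (List A)} {w : List A}
    {head : A → Prop} (hδ : ∀ x y z, ∀ r ∈ δ x y z, head y) {P S : List A} {x y z : A}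
    (hP : ∀ a ∈ P ++ [x], ¬ head a) (hS : ∀ a ∈ z :: S, ¬ head a) {t : List A} :
    (windowSystem δ w).Step ((P ++ [x]) ++ y :: z :: S) t ↔
      ∃ r ∈ δ x y z, t = P ++ r ++ S := by
  constructor
  · rintro ⟨p, hp, (u : List A), (v : List A), hs, rfl⟩
    obtain ⟨x', y', z', r, hr, rfl⟩ := mem_windowRules.1 hp
    have hy' := hδ _ _ _ _ hr
    replace hs : (P ++ [x]) ++ y :: z :: S = u ++ [x', y', z'] ++ v := hs
    have h : (P ++ [x]) ++ y :: z :: S = (u ++ [x']) ++ y' :: z' :: v := by simpa using hs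
    rw [List.append_cons_inj_of_notMem (fun h => hP _ h hy') (fun h => hS _ h hy')] at h
    obtain ⟨h1, rfl, h2⟩ := h
    obtain ⟨rfl, h3⟩ := List.append_inj' h1 rfl
    simp only [List.cons.injEq, and_true] at h2 h3
    obtain ⟨rfl, rfl⟩ := h2
    subst h3
    exact ⟨r, hr, rfl⟩
  · rintro ⟨r, hr, rfl⟩
    have h : (P ++ [x]) ++ y :: z :: S = P ++ [x, y, z] ++ S := by simp
    exact ⟨_, mem_windowRules.2 ⟨x, y, z, r, hr, rfl⟩, P, S, h, rfl⟩

end Window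

/-! ### Simulation of a Turing machine by string rewriting -/

open Turing

/-- The letters of the words describing the tape of a machine with states `Q` and tape alphabet
`Γ`: the states, which mark the head position, the contents of the cells, the two ends of the part
of the tape in use, the head `mark` of a word that only counts, and the counting letter `tick`. -/
inductive TapeLetter (Q Γ : Type)
  | state (q : Q)
  | cell (a : Γ)
  | leftEnd
  | rightEnd
  | mark
  | tick

namespace TapeLetter

variable {Q Γ : Type}

instance [Finite Q] [Finite Γ] : Finite (TapeLetter Q Γ) :=
  Finite.of_surjective (α := (Q ⊕ Γ) ⊕ Fin 4)
    (Sum.elim (Sum.elim state cell) ![leftEnd, rightEnd, mark, tick]) fun x => by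
    cases x with
    | state q => exact ⟨.inl (.inl q), rfl⟩
    | cell a => exact ⟨.inl (.inr a), rfl⟩
    | leftEnd => exact ⟨.inr 0, rfl⟩
    | rightEnd => exact ⟨.inr 1, rfl⟩
    | mark => exact ⟨.inr 2, rfl⟩
    | tick => exact ⟨.inr 3, rfl⟩

/-- The letters that mark the position at which a word is rewritten. -/
def IsHead : TapeLetter Q Γ → Prop
  | state _ => True
  | mark => True
  | _ => False

/-- The word for a tape with contents `l` (read leftwards) to the left of the head letter `y` and
`r` to its right, with `j` counting letters behind the head. -/
def word (l : List Γ) (y : TapeLetter Q Γ) (j : ℕ) (r : List Γ) : List (TapeLetter Q Γ) :=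
  (leftEnd :: l.reverse.map cell) ++ y :: (List.replicate j tick ++ (r.map cell ++ [rightEnd]))

theorem not_isHead_of_mem_left {l : List Γ} :
    ∀ a ∈ (leftEnd :: l.reverse.map cell : List (TapeLetter Q Γ)), ¬ a.IsHead := by
  simp [IsHead]

theorem not_isHead_of_mem_right {j : ℕ} {r : List Γ} :
    ∀ a ∈ (List.replicate j tick ++ (r.map cell ++ [rightEnd]) : List (TapeLetter Q Γ)),
      ¬ a.IsHead := by
  intro a ha
  simp only [List.mem_append, List.mem_replicate, List.mem_map, List.mem_singleton] at ha
  rcases ha with ⟨-, rfl⟩ | ⟨_, -, rfl⟩ | rfl <;> exact id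

theorem word_inj {l l' r r' : List Γ} {y y' : TapeLetter Q Γ} {j j' : ℕ} (hy' : y'.IsHead)
    (h : word l y j r = word l' y' j' r') : l = l' ∧ y = y' ∧ j = j' ∧ r = r' := by
  classical
  rw [word, word, List.append_cons_inj_of_notMem (fun h => not_isHead_of_mem_left _ h hy')
    (fun h => not_isHead_of_mem_right _ h hy')] at h
  obtain ⟨h1, rfl, h2⟩ := h
  have hc : Function.Injective (cell : Γ → TapeLetter Q Γ) := fun a b h => by cases h; rfl
  have h0 : ∀ r : List Γ, (r.map cell).count (tick : TapeLetter Q Γ) = 0 := fun r =>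
    List.count_eq_zero.2 (by simp)
  have hj : j = j' := by simpa [h0] using congrArg (List.count tick) h2
  subst hj
  simp only [List.cons.injEq, true_and, List.append_cancel_left_eq,
    List.append_cancel_right_eq] at h1 h2
  exact ⟨List.reverse_injective (hc.list_map h1), rfl, rfl, hc.list_map h2⟩

end TapeLetter

namespace Turing.TM0

open TapeLetter

variable {Q Γ : Type} [Inhabited Q] [Inhabited Γ] (M : Machine Γ Q)

/-- The words that may replace the window `x y z`. A machine head moves as the machine does, after
having added a blank cell on a side where it faces the end of the word. A halted machine is either
restarted or turned into a `mark`, which from then on only adds counting letters. -/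
def window : TapeLetter Q Γ → TapeLetter Q Γ → TapeLetter Q Γ → List (List (TapeLetter Q Γ))
  | x, mark, z => [[x, mark, tick, z]]
  | x, state q, rightEnd => [[x, state q, cell default, rightEnd]]
  | leftEnd, state q, cell a => [[leftEnd, cell default, state q, cell a]]
  | cell b, state q, cell a =>
    match M q a with
    | none => [[cell b, state default, cell a], [cell b, mark, cell a]]
    | some (q', .write c) => [[cell b, state q', cell c]]
    | some (q', .move .right) => [[cell b, cell a, state q']]
    | some (q', .move .left) => [[state q', cell b, cell a]]
  | _, _, _ => []

theorem isHead_of_mem_window (x y z) {r} (h : r ∈ window M x y z) : y.IsHead := by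
  cases y <;> simp [window, IsHead] at h ⊢

/-- A machine configuration with a finite tape: the contents to the left of the head (read
leftwards), the state, and the contents from the head on to the right. -/
abbrev FiniteCfg (Q Γ : Type) := List Γ × Q × List Γ

/-- The word for a configuration. -/
def FiniteCfg.toWord (c : FiniteCfg Q Γ) : List (TapeLetter Q Γ) :=
  word c.1 (state c.2.1) 0 c.2.2

/-- One step of the never-ending computation that restarts the machine whenever it halts. -/
def next : FiniteCfg Q Γ → FiniteCfg Q Γ
  | (l, q, []) => (l, q, [default])
  | ([], q, a :: r) => ([default], q, a :: r)
  | (b :: l, q, a :: r) =>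
    match M q a with
    | none => (b :: l, default, a :: r)
    | some (q', .write c) => (b :: l, q', c :: r)
    | some (q', .move .right) => (a :: b :: l, q', r)
    | some (q', .move .left) => (l, q', b :: a :: r)

/-- The configurations from which `next` restarts the machine. -/
def Halted : FiniteCfg Q Γ → Prop
  | (_ :: _, q, a :: _) => M q a = none
  | _ => False

variable [Finite Q] [Finite Γ] {w : List (TapeLetter Q Γ)}

theorem step_toWord_iff (c : FiniteCfg Q Γ) {t : List (TapeLetter Q Γ)} :
    (windowSystem (window M) w).Step c.toWord t ↔
      t = (next M c).toWord ∨ Halted M c ∧ t = word c.1 mark 0 c.2.2 := by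
  have key := fun P x y z S => windowSystem_step_iff (δ := window M) (w := w) (P := P) (x := x)
    (y := y) (z := z) (S := S) (fun x y z _ => isHead_of_mem_window M x y z) (t := t)
  obtain ⟨l, q, r⟩ := c
  rcases r with - | ⟨a, r⟩
  · obtain ⟨P, x, hPx⟩ :
      ∃ P x, (leftEnd :: l.reverse.map cell : List (TapeLetter Q Γ)) = P ++ [x] :=
      ⟨_, _, (List.dropLast_concat_getLast (List.cons_ne_nil _ _)).symm⟩
    have := key P x (state q) rightEnd [] (hPx ▸ not_isHead_of_mem_left) (by simp [IsHead])
    have hW : ∀ W, P ++ x :: W = leftEnd :: ((l.map cell).reverse ++ W) := fun W => by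
      simpa using (congrArg (· ++ W) hPx).symm
    rw [← hPx] at this
    simpa [FiniteCfg.toWord, word, next, Halted, window, hW] using this
  · rcases l with - | ⟨b, l⟩
    · have := key [] leftEnd (state q) (cell a) (r.map cell ++ [rightEnd]) (by simp [IsHead])
        (not_isHead_of_mem_right (j := 0) (r := a :: r))
      simpa [FiniteCfg.toWord, word, next, Halted, window] using this
    · have := key (leftEnd :: l.reverse.map cell) (cell b) (state q) (cell a)
        (r.map cell ++ [rightEnd])
        (by simpa using not_isHead_of_mem_left (Q := Q) (l := b :: l))
        (not_isHead_of_mem_right (j := 0) (r := a :: r))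
      rcases hM : M q a with - | ⟨q', (- | -) | c⟩ <;>
        simpa [FiniteCfg.toWord, word, next, Halted, window, hM] using this

theorem step_mark_iff (l r : List Γ) (j : ℕ) {t : List (TapeLetter Q Γ)} :
    (windowSystem (window M) w).Step (word l mark j r) t ↔ t = word l mark (j + 1) r := by
  obtain ⟨P, x, hPx⟩ :
      ∃ P x, (leftEnd :: l.reverse.map cell : List (TapeLetter Q Γ)) = P ++ [x] :=
    ⟨_, _, (List.dropLast_concat_getLast (List.cons_ne_nil _ _)).symm⟩
  obtain ⟨z, S, hzS⟩ : ∃ z S, (List.replicate j tick ++ (r.map cell ++ [rightEnd]) :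
      List (TapeLetter Q Γ)) = z :: S := List.exists_cons_of_ne_nil (by simp)
  have := windowSystem_step_iff (δ := window M) (w := w) (P := P) (x := x) (y := mark) (z := z)
    (S := S) (fun x y z _ => isHead_of_mem_window M x y z) (t := t)
    (hPx ▸ not_isHead_of_mem_left) (hzS ▸ not_isHead_of_mem_right)
  have hW : ∀ W, P ++ x :: W = leftEnd :: ((l.map cell).reverse ++ W) := fun W => by
    simpa using (congrArg (· ++ W) hPx).symm
  rw [← hPx, ← hzS] at this
  simpa [word, window, hW, hzS, List.replicate_succ] using this

end Turing.TM0

/-! ### Growth of a path with branches -/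

namespace MultiwaySystem

/-- Paths in a states graph that consists of one infinite main path `c`, from which an infinite
path `side i` branches off at each time `i` with `H i`. -/
theorem path_iff_of_branching {M : MultiwaySystem} {c : ℕ → List M.Alphabet} {H : ℕ → Prop}
    {side : ℕ → ℕ → List M.Alphabet} (h0 : M.init = c 0)
    (hc : ∀ i t, M.Step (c i) t ↔ t = c (i + 1) ∨ H i ∧ t = side i 0)
    (hs : ∀ i j t, M.Step (side i j) t ↔ t = side i (j + 1)) {d : ℕ} {s : List M.Alphabet} :
    M.Path d s ↔ s = c d ∨ ∃ i j, H i ∧ i + 1 + j = d ∧ s = side i j := by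
  constructor
  · intro h
    induction h with
    | init => exact .inl h0
    | step _ hst ih =>
      rcases ih with rfl | ⟨i, j, hi, rfl, rfl⟩
      · rcases (hc _ _).1 hst with rfl | ⟨hd, rfl⟩
        · exact .inl rfl
        · exact .inr ⟨_, 0, hd, rfl, rfl⟩
      · exact .inr ⟨i, j + 1, hi, rfl, (hs _ _ _).1 hst⟩
  · have hmain : ∀ i, M.Path i (c i) := by
      intro i
      induction i with
      | zero => exact h0 ▸ .init
      | succ i ih => exact ih.step ((hc _ _).2 (.inl rfl))
    rintro (rfl | ⟨i, j, hi, rfl, rfl⟩)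
    · exact hmain d
    · induction j with
      | zero => exact (hmain i).step ((hc _ _).2 (.inr ⟨hi, rfl⟩))
      | succ j ih => exact ih.step ((hs _ _ _).2 rfl)

/-- If moreover no state occurs twice, then the growth function counts the main path and the paths
that have branched off. -/
theorem growth_eq_of_branching {M : MultiwaySystem} {c : ℕ → List M.Alphabet} {H : ℕ → Prop}
    [DecidablePred H] {side : ℕ → ℕ → List M.Alphabet} (h0 : M.init = c 0)
    (hc : ∀ i t, M.Step (c i) t ↔ t = c (i + 1) ∨ H i ∧ t = side i 0)
    (hs : ∀ i j t, M.Step (side i j) t ↔ t = side i (j + 1))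
    (c_inj : Function.Injective c)
    (side_inj : ∀ i j i' j', H i → H i' → side i j = side i' j' → i = i' ∧ j = j')
    (c_ne_side : ∀ i i' j, c i ≠ side i' j) (n : ℕ+) :
    M.growth n = Nat.count H n.natPred + 1 := by
  classical
  have hp := @path_iff_of_branching M c H side h0 hc hs
  have huniq : ∀ d e s, M.Path d s → M.Path e s → d = e := by
    intro d e s hd he
    rw [hp] at hd he
    rcases hd with rfl | ⟨i, j, hi, rfl, rfl⟩ <;> rcases he with h | ⟨i', j', hi', rfl, h⟩
    · exact c_inj h
    · exact absurd h (c_ne_side _ _ _)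
    · exact absurd h.symm (c_ne_side _ _ _)
    · obtain ⟨rfl, rfl⟩ := side_inj _ _ _ _ hi hi' h
      rfl
  have hlayer : ∀ d, M.layer d =
      ((insert (c d) (((Finset.range d).filter H).image fun i => side i (d - (i + 1))) :
        Finset (List M.Alphabet)) : Set (List M.Alphabet)) := by
    intro d
    ext s
    have : s ∈ M.layer d ↔ M.Path d s :=
      ⟨fun h => h.1, fun h => ⟨h, fun e he h' => he.ne (huniq _ _ _ h' h)⟩⟩
    rw [this, hp]
    simp only [Finset.coe_insert, Set.mem_insert_iff, Finset.mem_coe, Finset.mem_image,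
      Finset.mem_filter, Finset.mem_range]
    refine or_congr_right ⟨?_, ?_⟩
    · rintro ⟨i, j, hi, rfl, rfl⟩
      exact ⟨i, ⟨by omega, hi⟩, by congr 1; omega⟩
    · rintro ⟨i, ⟨hid, hi⟩, rfl⟩
      exact ⟨i, _, hi, by omega, rfl⟩
  rw [growth, stateSet, hlayer, Set.ncard_coe_finset, Finset.card_insert_of_notMem,
    Finset.card_image_of_injOn, Nat.count_eq_card_filter_range]
  · intro i hi i' hi' h
    simp only [Finset.coe_filter, Set.mem_ofPred_eq] at hi hi'
    exact (side_inj _ _ _ _ hi.2 hi'.2 h).1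
  · simp only [Finset.mem_image, not_exists, not_and]
    exact fun i _ h => c_ne_side _ _ _ h.symm

end MultiwaySystem

/-! ### Runs of the restarted machine -/

namespace Turing.TM0

open TapeLetter Relation

variable {Q Γ : Type} [Inhabited Q] [Inhabited Γ] {M : Machine Γ Q}

/-- The machine configuration described by a configuration with a finite tape. -/
def FiniteCfg.toCfg (c : FiniteCfg Q Γ) : Cfg Γ Q :=
  ⟨c.2.1, Tape.mk' (ListBlank.mk c.1) (ListBlank.mk c.2.2)⟩

/-- The number of cells of a finite tape. -/
def FiniteCfg.size (c : FiniteCfg Q Γ) : ℕ := c.1.length + c.2.2.length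

theorem size_next_le (c : FiniteCfg Q Γ) : (next M c).size ≤ c.size + 1 := by
  obtain ⟨- | ⟨b, l⟩, q, - | ⟨a, r⟩⟩ := c <;>
    simp only [next, FiniteCfg.size, List.length_cons, List.length_nil] <;> try omega
  rcases M q a with - | ⟨q', (- | -) | c⟩ <;> simp only [List.length_cons] <;> omega

theorem size_iterate_next_le (c : FiniteCfg Q Γ) (i : ℕ) :
    ((next M)^[i] c).size ≤ i + c.size := by
  induction i with
  | zero => simp
  | succ i ih =>
    rw [Function.iterate_succ_apply']
    exact (size_next_le _).trans (by omega)

theorem next_of_halted {c : FiniteCfg Q Γ} (h : Halted M c) :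
    next M c = (c.1, default, c.2.2) := by
  obtain ⟨- | ⟨b, l⟩, q, - | ⟨a, r⟩⟩ := c <;> simp_all [Halted, next]

/-- A run of `next` that does not restart the machine. -/
def Runs (M : Machine Γ Q) : FiniteCfg Q Γ → FiniteCfg Q Γ → Prop :=
  ReflTransGen fun a b => ¬ Halted M a ∧ next M a = b

theorem exists_iterate_of_runs {a b : FiniteCfg Q Γ} (h : Runs M a b) :
    ∃ n, (next M)^[n] a = b ∧ ∀ i < n, ¬ Halted M ((next M)^[i] a) := by
  induction h with
  | refl => exact ⟨0, rfl, by simp⟩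
  | tail _ hbc ih =>
    obtain ⟨n, rfl, hn⟩ := ih
    refine ⟨n + 1, by rw [Function.iterate_succ_apply']; exact hbc.2, fun i hi => ?_⟩
    rcases Nat.lt_succ_iff_lt_or_eq.1 hi with hi | rfl
    exacts [hn i hi, hbc.1]

theorem mk_append_default (l : List Γ) : ListBlank.mk (l ++ [default]) = ListBlank.mk l :=
  (Quotient.sound' (Or.inl ⟨1, rfl⟩)).symm

/-- Adding blank cells, one reaches a configuration whose head has a cell on either side. -/
theorem exists_runs_cons (c : FiniteCfg Q Γ) :
    ∃ b l q a r, Runs M c (b :: l, q, a :: r) ∧ FiniteCfg.toCfg (b :: l, q, a :: r) = c.toCfg := by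
  have hnil : (ListBlank.mk [default] : ListBlank Γ) = ListBlank.mk [] := mk_append_default []
  have h1 : ∀ l q (a : Γ) r, ∃ b l' q' a' r', Runs M (l, q, a :: r) (b :: l', q', a' :: r') ∧
      FiniteCfg.toCfg (b :: l', q', a' :: r') = FiniteCfg.toCfg (l, q, a :: r) := by
    rintro (- | ⟨b, l⟩) q a r
    · exact ⟨_, _, _, _, _, .single ⟨id, rfl⟩, by simp only [FiniteCfg.toCfg, hnil]⟩
    · exact ⟨_, _, _, _, _, .refl, rfl⟩
  obtain ⟨l, q, - | ⟨a, r⟩⟩ := c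
  · obtain ⟨b, l', q', a', r', h, h'⟩ := h1 l q default []
    have hr : Runs M (l, q, []) (l, q, [default]) :=
      .single ⟨by cases l <;> exact id, by cases l <;> rfl⟩
    exact ⟨b, l', q', a', r', hr.trans h, by rw [h']; simp only [FiniteCfg.toCfg, hnil]⟩
  · exact h1 l q a r

theorem exists_runs_of_mem_step {c : FiniteCfg Q Γ} {C : Cfg Γ Q} (h : C ∈ step M c.toCfg) :
    ∃ c', Runs M c c' ∧ c'.toCfg = C := by
  obtain ⟨b, l, q, a, r, hr, hc⟩ := exists_runs_cons (M := M) c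
  rw [← hc] at h
  have hM : ¬ Halted M (b :: l, q, a :: r) := fun hM => by
    simp_all [FiniteCfg.toCfg, step, Halted]
  refine ⟨next M (b :: l, q, a :: r), hr.tail ⟨hM, rfl⟩, ?_⟩
  rcases hM : M q a with - | ⟨q', (- | -) | c⟩ <;>
    simp [FiniteCfg.toCfg, step, hM] at h <;>
    simp [← h, FiniteCfg.toCfg, next, hM, ← ListBlank.cons_mk]

theorem exists_runs_of_reaches {c : FiniteCfg Q Γ} {C : Cfg Γ Q}
    (h : StateTransition.Reaches (step M) c.toCfg C) : ∃ c', Runs M c c' ∧ c'.toCfg = C := by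
  induction h with
  | refl => exact ⟨c, .refl, rfl⟩
  | tail _ h ih =>
    obtain ⟨c', hc', rfl⟩ := ih
    obtain ⟨c'', hc'', rfl⟩ := exists_runs_of_mem_step h
    exact ⟨c'', hc'.trans hc'', rfl⟩

theorem exists_runs_halted {c : FiniteCfg Q Γ} {q : Q} {L R : ListBlank Γ}
    (hc : c.toCfg = ⟨q, Tape.mk' L R⟩) (h : M q R.head = none) :
    ∃ c', Runs M c c' ∧ Halted M c' ∧ (next M c').toCfg = ⟨default, Tape.mk' L R⟩ := by
  obtain ⟨b, l, q, a, r, hr, hc'⟩ := exists_runs_cons (M := M) c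
  rw [hc] at hc'
  simp only [FiniteCfg.toCfg, Cfg.mk.injEq] at hc'
  obtain ⟨rfl, hT⟩ := hc'
  have hR : ListBlank.mk (a :: r) = R := by simpa using congrArg Tape.right₀ hT
  have hh : Halted M (b :: l, q, a :: r) := by
    rw [← hR] at h
    simpa [Halted] using h
  refine ⟨_, hr, hh, ?_⟩
  rw [next_of_halted hh, FiniteCfg.toCfg, hT]

/-- One round of the never-ending computation: from a start configuration it halts exactly once
before it has reached the next start configuration. -/
theorem exists_restart {c : FiniteCfg Q Γ} {R R' : ListBlank Γ} {q : Q}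
    (hc : c.toCfg = ⟨default, Tape.mk' ∅ R⟩)
    (h : StateTransition.Reaches (step M) ⟨default, Tape.mk' ∅ R⟩ ⟨q, Tape.mk' ∅ R'⟩)
    (hq : M q R'.head = none) :
    ∃ n, Halted M ((next M)^[n] c) ∧ (∀ i < n, ¬ Halted M ((next M)^[i] c)) ∧
      ((next M)^[n + 1] c).toCfg = ⟨default, Tape.mk' ∅ R'⟩ := by
  obtain ⟨c', hr, hc'⟩ := exists_runs_of_reaches (hc ▸ h)
  obtain ⟨c'', hr', hh, hn⟩ := exists_runs_halted hc' hq
  obtain ⟨n, rfl, hi⟩ := exists_iterate_of_runs (hr.trans hr')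
  exact ⟨n, hh, hi, by rw [Function.iterate_succ_apply']; exact hn⟩

end Turing.TM0

namespace Turing.TM0

open TapeLetter

variable {Q Γ : Type} [Inhabited Γ]

/-- A finite tape that holds `n` has at least as many cells as `n` has binary digits. -/
theorem lt_two_pow_of_toCfg_eq {E : ℕ → ListBlank Γ → Prop}
    (hlen : ∀ n l, E n (ListBlank.mk l) → n < 2 ^ l.length) {c : FiniteCfg Q Γ} {R : ListBlank Γ}
    {q : Q} {n : ℕ} (hR : E n R) (hc : c.toCfg = ⟨q, Tape.mk' ∅ R⟩) : n < 2 ^ c.size := by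
  simp only [FiniteCfg.toCfg, Cfg.mk.injEq] at hc
  have h : ListBlank.mk c.2.2 = R := by simpa using congrArg Tape.right₀ hc.2
  subst h
  exact (hlen _ _ hR).trans_le (Nat.pow_le_pow_right two_pos (Nat.le_add_left _ _))

variable [Inhabited Q] {M : Machine Γ Q}

/-- After `k` restarts, a machine computing `φ` holds the `k`-th iterate of `φ`. -/
theorem exists_start_of_iterate {φ : ℕ → ℕ} {E : ℕ → ListBlank Γ → Prop}
    (hE : ∀ n R, E n R → ∃ q R', E (φ n) R' ∧
      StateTransition.Reaches (step M) ⟨default, Tape.mk' ∅ R⟩ ⟨q, Tape.mk' ∅ R'⟩ ∧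
      M q R'.head = none)
    {c : FiniteCfg Q Γ} {R : ListBlank Γ} (hR : E 0 R) (hc : c.toCfg = ⟨default, Tape.mk' ∅ R⟩)
    [DecidablePred fun i => Halted M ((next M)^[i] c)] (k : ℕ) :
    ∃ t R, E (φ^[k] 0) R ∧ ((next M)^[t] c).toCfg = ⟨default, Tape.mk' ∅ R⟩ ∧
      Nat.count (fun i => Halted M ((next M)^[i] c)) t = k := by
  induction k with
  | zero => exact ⟨0, R, hR, hc, Nat.count_zero _⟩
  | succ k ih =>
    obtain ⟨t, R, hR, ht, hk⟩ := ih
    obtain ⟨q, R', hR', hreach, hq⟩ := hE _ _ hR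
    obtain ⟨n, hn, hlt, hn'⟩ := exists_restart ht hreach hq
    simp only [← Function.iterate_add_apply] at hn hlt hn'
    refine ⟨n + 1 + t, R', by rwa [Function.iterate_succ_apply'], hn', ?_⟩
    have h0 : Nat.count (fun i => Halted M ((next M)^[t + i] c)) n = 0 := by
      rw [Nat.count_eq_card_filter_range, Finset.card_eq_zero, Finset.filter_eq_empty_iff]
      intro i hi
      rw [add_comm]
      exact hlt i (Finset.mem_range.1 hi)
    rw [add_comm, ← add_assoc, Nat.count_succ, if_pos (by rwa [add_comm]), Nat.count_add, hk, h0]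

end Turing.TM0

/-- An orbit on which some function is unbounded never returns to a point, as it would be finite
otherwise. -/
theorem Function.iterate_injective_of_unbounded {α : Type*} {f : α → α} {a : α} (s : α → ℕ)
    (h : ∀ k, ∃ n, k < s (f^[n] a)) : Function.Injective fun n => f^[n] a := by
  have key : ∀ i j, i < j → f^[i] a ≠ f^[j] a := by
    intro i j hij heq
    have hfin : ∀ n, ∃ m < j, f^[n] a = f^[m] a := by
      intro n
      induction n using Nat.strong_induction_on with
      | _ n ih =>
        rcases lt_or_ge n j with hn | hn
        · exact ⟨n, hn, rfl⟩
        · obtain ⟨m, hm, h⟩ := ih (n - j + i) (by omega)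
          refine ⟨m, hm, ?_⟩
          rw [← h, Function.iterate_add_apply, heq, ← Function.iterate_add_apply]
          congr 2
          omega
    obtain ⟨n, hn⟩ := h ((Finset.range j).sup fun m => s (f^[m] a))
    obtain ⟨m, hm, h⟩ := hfin n
    rw [h] at hn
    exact hn.not_ge (Finset.le_sup (f := fun m => s (f^[m] a)) (Finset.mem_range.2 hm))
  intro i j hij
  by_contra hne
  rcases Nat.lt_or_gt_of_ne hne with h | h
  exacts [key i j h hij, key j i h hij.symm]

/-! ### A multiway system of slow growth -/

open Turing TM0 TapeLetter in
/-- The system that iterates `φ` from `0` and, after each evaluation, starts another path on which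
nothing but a counter changes. The bound on its growth comes from the length of the words: it takes
more than `n` steps to write down a number with more than `n` digits. -/
theorem MultiwaySystem.exists_slow_growth {φ : ℕ → ℕ} (hφ : Computable φ)
    (hk : ∀ k, k ≤ φ^[k] 0) :
    ∃ M : MultiwaySystem, Monotone M.growth ∧ (∀ n, 1 ≤ M.growth n) ∧
      (∀ k, ∃ n, k ≤ M.growth n) ∧
      ∃ s, ∀ (k : ℕ) (n : ℕ+), 2 ^ ((n : ℕ) + s) ≤ φ^[k] 0 → M.growth n ≤ k + 1 := by
  classical
  obtain ⟨Γ, Q, _, _, _, _, M, E, ⟨R, hR⟩, hE, hlen⟩ := exists_restartable_machine hφ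
  obtain ⟨r, rfl⟩ : ∃ r, ListBlank.mk r = R := Quotient.exists_rep R
  let c₀ : FiniteCfg Q Γ := ([], default, r)
  let c : ℕ → FiniteCfg Q Γ := fun i => (next M)^[i] c₀
  have hstart := exists_start_of_iterate hE hR (c := c₀) rfl
  have hsize : ∀ i, (c i).size ≤ i + c₀.size := size_iterate_next_le c₀
  have c_inj : Function.Injective c := by
    refine Function.iterate_injective_of_unbounded FiniteCfg.size fun k => ?_
    obtain ⟨t, R, hR, ht, -⟩ := hstart (2 ^ k)
    exact ⟨t, (Nat.pow_lt_pow_iff_right one_lt_two).1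
      ((hk _).trans_lt (lt_two_pow_of_toCfg_eq hlen hR ht))⟩
  have hgrowth : ∀ n : ℕ+, (windowSystem (window M) c₀.toWord).growth n =
      Nat.count (fun i => Halted M (c i)) n.natPred + 1 := by
    refine growth_eq_of_branching (c := fun i => (c i).toWord)
      (side := fun i j => word (c i).1 mark j (c i).2.2) rfl ?_ (fun i j t => step_mark_iff ..)
      ?_ ?_ ?_
    · intro i t
      have : c (i + 1) = next M (c i) := Function.iterate_succ_apply' _ _ _
      rw [this]
      exact step_toWord_iff M (c i)
    · intro i j h
      obtain ⟨h1, h2, -, h3⟩ := word_inj (by trivial) h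
      simp only [state.injEq] at h2
      exact c_inj (Prod.ext h1 (Prod.ext h2 h3))
    · intro i j i' j' hi hi' h
      obtain ⟨h1, -, h2, h3⟩ := word_inj (by trivial) h
      -- The state is forgotten on a side path, but after a restart it is the same for both.
      refine ⟨Nat.succ_injective (c_inj ?_), h2⟩
      simp only [c, Function.iterate_succ_apply'] at hi hi' h1 h3 ⊢
      rw [next_of_halted hi, next_of_halted hi', h1, h3]
    · intro i i' j h
      obtain ⟨-, h, -⟩ := word_inj (by trivial) h
      cases h
  refine ⟨windowSystem (window M) c₀.toWord, fun m n hmn => ?_, fun n => ?_,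
    fun k => ?_, c₀.size, fun k n hn => ?_⟩
  · rw [hgrowth, hgrowth]
    exact Nat.succ_le_succ (Nat.count_monotone _ (PNat.natPred_monotone hmn))
  · rw [hgrowth]
    exact Nat.le_add_left _ _
  · obtain ⟨t, -, -, -, ht⟩ := hstart k
    refine ⟨t.succPNat, ?_⟩
    rw [hgrowth, Nat.natPred_succPNat, ht]
    exact Nat.le_succ k
  · obtain ⟨t, R, hR, hR', ht⟩ := hstart k
    rw [hgrowth]
    refine Nat.succ_le_succ (ht ▸ Nat.count_monotone _ ?_)
    have h1 := (Nat.pow_lt_pow_iff_right one_lt_two).1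
      (hn.trans_lt (lt_two_pow_of_toCfg_eq hlen hR hR'))
    have h2 := hsize t
    have h3 : n.natPred ≤ n := Nat.sub_le _ _
    simp only [c] at h2
    omega

/-! ### Polygonal chains -/

section Interpolation

/-- The values of the polygonal chain of `g` at the natural numbers. -/
def nodeValue (g : ℕ+ → ℕ) (n : ℕ) : ℝ := if h : 0 < n then (g ⟨n, h⟩ : ℝ) else 0

theorem nodeValue_nonneg (g : ℕ+ → ℕ) (n : ℕ) : 0 ≤ nodeValue g n := by
  unfold nodeValue
  split_ifs <;> positivity

theorem nodeValue_coe (g : ℕ+ → ℕ) (n : ℕ+) : nodeValue g n = g n := dif_pos n.pos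

theorem nodeValue_monotone {g : ℕ+ → ℕ} (hg : Monotone g) : Monotone (nodeValue g) := by
  intro m n hmn
  rcases Nat.eq_zero_or_pos m with rfl | hm
  · exact nodeValue_nonneg g n
  · have hn := hm.trans_le hmn
    simp only [nodeValue, hm, hn, dif_pos, Nat.cast_le]
    exact hg hmn

theorem linearInterpolation_eq (g : ℕ+ → ℕ) (x : ℝ≥0) :
    linearInterpolation g x = nodeValue g ⌊x⌋₊ +
      ((x : ℝ) - ⌊x⌋₊) * (nodeValue g (⌊x⌋₊ + 1) - nodeValue g ⌊x⌋₊) := rfl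

/-- The formula for a segment also holds at its right end. -/
theorem linearInterpolation_of_mem_Icc (g : ℕ+ → ℕ) {n : ℕ} {x : ℝ≥0}
    (hx : x ∈ Set.Icc (n : ℝ≥0) (n + 1)) : linearInterpolation g x =
      nodeValue g n + ((x : ℝ) - n) * (nodeValue g (n + 1) - nodeValue g n) := by
  rcases hx.2.lt_or_eq with h | h
  · have : ⌊x⌋₊ = n := (Nat.floor_eq_iff x.2).2 ⟨hx.1, h⟩
    rw [linearInterpolation_eq, this]
  · have : ⌊x⌋₊ = n + 1 := by rw [h]; exact_mod_cast Nat.floor_natCast (R := ℝ≥0) (n + 1)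
    rw [linearInterpolation_eq, this, h]
    push_cast
    ring

theorem continuous_linearInterpolation (g : ℕ+ → ℕ) : Continuous (linearInterpolation g) := by
  refine LocallyFinite.continuous (f := fun n : ℕ => Set.Icc (n : ℝ≥0) (n + 1)) ?_ ?_
    (fun n => isClosed_Icc) fun n => ?_
  · intro x
    refine ⟨Set.Iio (x + 1), Iio_mem_nhds (lt_add_one x),
      (Set.finite_lt_nat (⌊x⌋₊ + 2)).subset ?_⟩
    rintro n ⟨y, hy, hy'⟩
    have h : (n : ℝ≥0) < ↑(⌊x⌋₊ + 2) := by
      refine (hy.1.trans_lt hy').trans ?_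
      have := Nat.lt_floor_add_one x
      push_cast
      calc x + 1 < ⌊x⌋₊ + 1 + 1 := by gcongr
        _ = ⌊x⌋₊ + 2 := by ring
    exact_mod_cast h
  · refine Set.eq_univ_of_forall fun x => Set.mem_iUnion.2 ⟨⌊x⌋₊, Nat.floor_le x.2, ?_⟩
    exact (Nat.lt_floor_add_one x).le
  · refine ContinuousOn.congr (f := fun x : ℝ≥0 => nodeValue g n +
      ((x : ℝ) - n) * (nodeValue g (n + 1) - nodeValue g n)) ?_
      fun x hx => linearInterpolation_of_mem_Icc g hx
    fun_prop

theorem linearInterpolation_le {g : ℕ+ → ℕ} {x : ℝ≥0} {b : ℝ} (h₀ : nodeValue g ⌊x⌋₊ ≤ b)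
    (h₁ : nodeValue g (⌊x⌋₊ + 1) ≤ b) : linearInterpolation g x ≤ b := by
  have h2 : (⌊x⌋₊ : ℝ) ≤ x := by exact_mod_cast Nat.floor_le x.2
  have h3 : (x : ℝ) < ⌊x⌋₊ + 1 := by exact_mod_cast Nat.lt_floor_add_one x
  rw [linearInterpolation_eq]
  nlinarith

theorem le_linearInterpolation {g : ℕ+ → ℕ} {x : ℝ≥0} {b : ℝ} (h₀ : b ≤ nodeValue g ⌊x⌋₊)
    (h₁ : b ≤ nodeValue g (⌊x⌋₊ + 1)) : b ≤ linearInterpolation g x := by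
  have h2 : (⌊x⌋₊ : ℝ) ≤ x := by exact_mod_cast Nat.floor_le x.2
  have h3 : (x : ℝ) < ⌊x⌋₊ + 1 := by exact_mod_cast Nat.lt_floor_add_one x
  rw [linearInterpolation_eq]
  nlinarith

theorem linearInterpolation_nonneg (g : ℕ+ → ℕ) (x : ℝ≥0) : 0 ≤ linearInterpolation g x :=
  le_linearInterpolation (nodeValue_nonneg _ _) (nodeValue_nonneg _ _)

theorem linearInterpolation_zero (g : ℕ+ → ℕ) : linearInterpolation g 0 = 0 := by
  simp [linearInterpolation_eq, nodeValue]

theorem linearInterpolation_monotone {g : ℕ+ → ℕ} (hg : Monotone g) :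
    Monotone (linearInterpolation g) := by
  intro x y hxy
  have hn := nodeValue_monotone hg
  rcases (Nat.floor_mono hxy).lt_or_eq with h | h
  · calc linearInterpolation g x ≤ nodeValue g (⌊x⌋₊ + 1) :=
        linearInterpolation_le (hn (Nat.le_succ _)) le_rfl
      _ ≤ nodeValue g ⌊y⌋₊ := hn h
      _ ≤ linearInterpolation g y := le_linearInterpolation le_rfl (hn (Nat.le_succ _))
  · rw [linearInterpolation_eq, linearInterpolation_eq, h]
    have := hn (Nat.le_succ ⌊y⌋₊)
    have : (x : ℝ) ≤ y := hxy
    gcongr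

theorem tendsto_linearInterpolation {g : ℕ+ → ℕ} (hg : Tendsto (nodeValue g) atTop atTop) :
    Tendsto (linearInterpolation g) atTop atTop := by
  refine tendsto_atTop.2 fun b => ?_
  obtain ⟨N, hN⟩ := eventually_atTop.1 (tendsto_atTop.1 hg b)
  filter_upwards [eventually_ge_atTop (N : ℝ≥0)] with x hx
  have h := Nat.le_floor hx
  exact le_linearInterpolation (hN _ h) (hN _ (h.trans (Nat.le_succ _)))

end Interpolation

/-! ### Tight bounds of nondecreasing sequences -/

section TightBounds

theorem upperSeq_eq {g : ℕ+ → ℕ} (hg : Monotone g) : upperSeq g = g := by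
  funext n
  exact IsGreatest.csSup_eq ⟨⟨n, le_rfl, rfl⟩, by rintro _ ⟨k, hk, rfl⟩; exact hg hk⟩

theorem lowerSeq_eq {g : ℕ+ → ℕ} (hg : Monotone g) (h1 : ∀ n, 1 ≤ g n) : lowerSeq g = g := by
  funext n
  refine IsGreatest.csSup_eq ⟨.inl ⟨n, le_rfl, fun l hl => hg hl, rfl⟩, ?_⟩
  rintro _ (⟨k, hk, -, rfl⟩ | rfl)
  exacts [hg hk, h1 n]

/-- The polygonal chain of `g`, made strictly increasing by adding a bounded function. -/
noncomputable def strictInterpolation (g : ℕ+ → ℕ) (x : ℝ≥0) : ℝ≥0 :=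
  ⟨linearInterpolation g x, linearInterpolation_nonneg g x⟩ + x / (1 + x)

theorem coe_strictInterpolation (g : ℕ+ → ℕ) (x : ℝ≥0) :
    (strictInterpolation g x : ℝ) = linearInterpolation g x + x / (1 + x) := rfl

theorem div_one_add_lt_one (x : ℝ≥0) : x / (1 + x) < 1 := by
  rw [div_lt_one (by positivity)]
  exact lt_one_add x

theorem strictMono_div_one_add : StrictMono fun x : ℝ≥0 => x / (1 + x) := by
  intro x y hxy
  have : (x : ℝ) < y := hxy
  change ((x / (1 + x) : ℝ≥0) : ℝ) < ((y / (1 + y) : ℝ≥0) : ℝ)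
  push_cast
  rw [div_lt_div_iff₀ (by positivity) (by positivity)]
  linarith

theorem tendsto_atBot_of_map_zero {F : ℝ≥0 → ℝ≥0} (h : F 0 = 0) : Tendsto F atBot atBot := by
  rw [OrderBot.atBot_eq, bot_eq_zero]
  simpa only [h] using tendsto_pure_pure F 0

theorem continuous_strictInterpolation (g : ℕ+ → ℕ) : Continuous (strictInterpolation g) := by
  have h : Continuous fun x : ℝ≥0 =>
      (⟨linearInterpolation g x, linearInterpolation_nonneg g x⟩ : ℝ≥0) :=
    (continuous_linearInterpolation g).subtype_mk _
  exact Continuous.add (M := ℝ≥0) h (continuous_id.div (by fun_prop) fun x => by positivity)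

theorem strictInterpolation_bijective {g : ℕ+ → ℕ} (hg : Monotone g)
    (hg' : Tendsto (nodeValue g) atTop atTop) : Function.Bijective (strictInterpolation g) := by
  refine ⟨StrictMono.injective fun x y hxy => ?_, ?_⟩
  · exact add_lt_add_of_le_of_lt (linearInterpolation_monotone hg hxy.le)
      (strictMono_div_one_add hxy)
  · refine (continuous_strictInterpolation g).surjective ?_ ?_
    · refine NNReal.tendsto_coe_atTop.1 (tendsto_atTop_mono (fun x => ?_)
        (tendsto_linearInterpolation hg'))
      rw [coe_strictInterpolation]
      exact le_add_of_nonneg_right (by positivity)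
    · refine tendsto_atBot_of_map_zero (NNReal.coe_injective ?_)
      simp [coe_strictInterpolation, linearInterpolation_zero]

theorem strictInterpolation_isTheta {g : ℕ+ → ℕ} (hg : Tendsto (nodeValue g) atTop atTop) :
    (fun x => (strictInterpolation g x : ℝ)) =Θ[atTop] linearInterpolation g := by
  have h : ∀ x : ℝ≥0, (x : ℝ) / (1 + x) ≤ 1 := fun x => by exact_mod_cast (div_one_add_lt_one x).le
  constructor
  · refine IsBigO.of_bound 2 ?_
    filter_upwards [(tendsto_linearInterpolation hg).eventually_ge_atTop 1] with x hx
    rw [Real.norm_of_nonneg (by positivity), Real.norm_of_nonneg (by positivity),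
      coe_strictInterpolation]
    linarith [h x]
  · refine IsBigO.of_bound 1 (Eventually.of_forall fun x => ?_)
    rw [Real.norm_of_nonneg (linearInterpolation_nonneg g x), Real.norm_of_nonneg (by positivity),
      coe_strictInterpolation, one_mul]
    exact le_add_of_nonneg_right (by positivity)

end TightBounds

/-! ### Existence of asymptotic inverses -/

section AsymptoticInverse

/-- A function tending to infinity has an asymptotic inverse tending to infinity. Neither the
function nor its polygonal chain need be monotone or injective, so the inverse is not continuous in
general: by the Schröder–Bernstein theorem there is a bijection of the half-line that maps each
level set `{x | n ≤ F x < n + 1}` of the polygonal chain `F` onto `[n, n + 1)`. -/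
theorem exists_isAsymptoticInverse {f : ℕ → ℕ} (hf : Tendsto f atTop atTop) :
    ∃ h, IsAsymptoticInverse f h ∧ Tendsto h atTop atTop := by
  set g : ℕ+ → ℕ := fun n => f n with hgdef
  have hg : Tendsto (nodeValue g) atTop atTop := by
    refine (tendsto_natCast_atTop_atTop.comp hf).congr' ?_
    filter_upwards [eventually_gt_atTop 0] with n hn
    simp [nodeValue, hn, hgdef]
  let F : ℝ≥0 → ℝ≥0 := fun x => ⟨linearInterpolation g x, linearInterpolation_nonneg g x⟩
  have hFc : Continuous F := (continuous_linearInterpolation g).subtype_mk _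
  have hFt : Tendsto F atTop atTop := NNReal.tendsto_coe_atTop.1 (tendsto_linearInterpolation hg)
  have hFs : Function.Surjective F := by
    exact hFc.surjective hFt
      (tendsto_atBot_of_map_zero (NNReal.coe_injective (linearInterpolation_zero g)))
  have hfl : ∀ (n : ℕ) (x : ℝ≥0), ⌊(n : ℝ≥0) + x / (1 + x)⌋₊ = n := fun n x =>
    (Nat.floor_eq_iff (by positivity)).2
      ⟨le_add_of_nonneg_right (by positivity), by gcongr; exact div_one_add_lt_one x⟩
  obtain ⟨k, hk, hkF⟩ := Function.Embedding.schroeder_bernstein_of_rel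
    (f := fun x => (⌊F x⌋₊ : ℝ≥0) + x / (1 + x)) (g := Function.surjInv hFs)
    (fun x y hxy => by
      have h : ⌊F x⌋₊ = ⌊F y⌋₊ := by simpa only [hfl] using congrArg Nat.floor hxy
      simp only [h, add_right_inj] at hxy
      exact strictMono_div_one_add.injective hxy)
    (Function.injective_surjInv hFs) (fun x y => ⌊F x⌋₊ = ⌊y⌋₊) (fun x => (hfl _ x).symm)
    (fun y => by rw [Function.surjInv_eq hFs])
  have h1 : ∀ x, k x < F x + 1 := fun x => by
    calc k x < ⌊k x⌋₊ + 1 := Nat.lt_floor_add_one _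
      _ = ⌊F x⌋₊ + 1 := by rw [hkF]
      _ ≤ F x + 1 := by gcongr; exact Nat.floor_le zero_le
  have h2 : ∀ x, F x < k x + 1 := fun x => by
    calc F x < ⌊F x⌋₊ + 1 := Nat.lt_floor_add_one _
      _ = ⌊k x⌋₊ + 1 := by rw [hkF]
      _ ≤ k x + 1 := by gcongr; exact Nat.floor_le zero_le
  let e := Equiv.ofBijective k hk
  refine ⟨e.symm, ⟨k, e.right_inv, e.left_inv, ?_, ?_⟩, ?_⟩
  · refine IsBigO.of_bound 2 ?_
    filter_upwards [hFt.eventually_ge_atTop 1] with x hx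
    have h1 : (k x : ℝ) < F x + 1 := h1 x
    have hx : (1 : ℝ) ≤ F x := hx
    rw [Real.norm_of_nonneg (by positivity), Real.norm_of_nonneg (linearInterpolation_nonneg g x)]
    change (k x : ℝ) ≤ 2 * F x
    linarith
  · refine IsBigO.of_bound 2 ?_
    filter_upwards [hFt.eventually_ge_atTop 2] with x hx
    have h2 : (F x : ℝ) < k x + 1 := h2 x
    have hx : (2 : ℝ) ≤ F x := hx
    rw [Real.norm_of_nonneg (linearInterpolation_nonneg g x), Real.norm_of_nonneg (by positivity)]
    change (F x : ℝ) ≤ 2 * k x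
    linarith
  · refine tendsto_atTop.2 fun b => ?_
    obtain ⟨B, hB⟩ := (isCompact_Icc (a := (0 : ℝ≥0)) (b := b)).bddAbove_image hFc.continuousOn
    filter_upwards [eventually_ge_atTop (B + 1)] with y hy
    by_contra! hlt
    have h3 : F (e.symm y) ≤ B := hB ⟨_, ⟨zero_le, hlt.le⟩, rfl⟩
    have h4 : k (e.symm y) = y := e.right_inv y
    have h5 := h1 (e.symm y)
    rw [h4] at h5
    exact (h5.trans_le (by gcongr)).not_ge hy

end AsymptoticInverse

/-! ### Comparison with asymptotic inverses -/

section FastIteration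

/-- The function `n ↦ n * ∑ i ≤ n, f i + n`. The sum is a monotone bound for `f`, the factor `n`
absorbs the constants in asymptotic comparisons, and the summand `n` additive constants. -/
def iterationExponent (f : ℕ → ℕ) (n : ℕ) : ℕ := n * (∑ i ∈ Finset.range (n + 1), f i) + n

theorem iterationExponent_monotone (f : ℕ → ℕ) : Monotone (iterationExponent f) := by
  intro m n hmn
  unfold iterationExponent
  gcongr

theorem computable_iterationExponent {f : ℕ → ℕ} (hf : Computable f) :
    Computable (iterationExponent f) := by
  have hsum : Computable fun n => ∑ i ∈ Finset.range n, f i := by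
    have h : Computable fun n : ℕ => (Nat.rec 0 (fun i s => s + f i) n : ℕ) :=
      Computable.nat_rec (h := fun _ p => p.2 + f p.1) Computable.id (Computable.const 0)
        (Primrec.nat_add.to_comp.comp (Computable.snd.comp Computable.snd)
          (hf.comp (Computable.fst.comp Computable.snd)))
    refine h.of_eq fun n => ?_
    induction n with
    | zero => rfl
    | succ n ih => rw [Finset.sum_range_succ, ← ih]
  exact Primrec.nat_add.to_comp.comp
    (Primrec.nat_mul.to_comp.comp Computable.id (hsum.comp Computable.succ)) Computable.id

theorem computable_two_pow : Computable fun n : ℕ => 2 ^ n := by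
  have h : Computable fun n : ℕ => (Nat.rec 1 (fun _ s => s * 2) n : ℕ) :=
    Computable.nat_rec (h := fun _ p => p.2 * 2) Computable.id (Computable.const 1)
      (Primrec.nat_mul.to_comp.comp (Computable.snd.comp Computable.snd) (Computable.const 2))
  refine h.of_eq fun n => ?_
  induction n with
  | zero => rfl
  | succ n ih => rw [pow_succ, ← ih]

theorem le_iterate_of_two_pow {e φ : ℕ → ℕ} (he : ∀ n, n ≤ e n)
    (hφ : ∀ x, φ x = 2 ^ e (x + 1)) (k : ℕ) : k ≤ φ^[k] 0 := by
  induction k with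
  | zero => exact Nat.zero_le _
  | succ k ih =>
    rw [Function.iterate_succ_apply', hφ]
    exact (Nat.succ_le_succ ih).trans ((he _).trans Nat.lt_two_pow_self.le)

theorem two_pow_le_iterate {e φ : ℕ → ℕ} (he : ∀ n, n ≤ e n) (he' : Monotone e)
    (hφ : ∀ x, φ x = 2 ^ e (x + 1)) {k : ℕ} (hk : 0 < k) : 2 ^ e k ≤ φ^[k] 0 := by
  obtain ⟨k, rfl⟩ := Nat.exists_eq_succ_of_ne_zero hk.ne'
  rw [Function.iterate_succ_apply', hφ]
  exact Nat.pow_le_pow_right two_pos (he' (Nat.succ_le_succ (le_iterate_of_two_pow he hφ k)))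

end FastIteration

/-- A sequence that is at most `n + 1` up to about the time `n * ∑ i ≤ n, f i` grows more slowly
than every asymptotic inverse `h` of `f` tending to infinity: a large `x` is at most a constant
multiple of the polygonal chain of `f` at `h x`, hence at most `n * ∑ i ≤ n, f i` for
`n = ⌊h x⌋ + 1`. -/
theorem inBigO_strictInterpolation {f : ℕ → ℕ} {g : ℕ+ → ℕ} (hg : Monotone g) {s : ℕ}
    (hs : ∀ (k : ℕ) (n : ℕ+), 0 < k → n + s ≤ iterationExponent f k → g n ≤ k + 1)
    {h : ℝ≥0 → ℝ≥0} (hh : IsAsymptoticInverse f h) (hh' : Tendsto h atTop atTop) :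
    InBigO (strictInterpolation g) h := by
  obtain ⟨k, hkh, -, hk, -⟩ := hh
  obtain ⟨c, hc⟩ := hk.bound
  refine IsBigO.of_bound 4 ?_
  filter_upwards [hh'.eventually hc, hh'.eventually_ge_atTop c.toNNReal,
    hh'.eventually_ge_atTop ((s : ℝ≥0) + 1)] with x hx hxc hxs
  rw [hkh x, Real.norm_of_nonneg (by positivity),
    Real.norm_of_nonneg (linearInterpolation_nonneg _ _)] at hx
  rw [Real.norm_of_nonneg (by positivity), Real.norm_of_nonneg (by positivity)]
  set n := ⌊h x⌋₊ + 1 with hn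
  set S := ∑ i ∈ Finset.range (n + 1), f i with hS
  have hhn : (h x : ℝ) ≤ n := by
    have := (Nat.lt_floor_add_one (h x)).le
    exact_mod_cast this
  have hnh : (n : ℝ) ≤ h x + 1 := by
    have := Nat.floor_le (h x).2
    rw [hn]
    push_cast
    gcongr
    exact_mod_cast this
  have hcn : c ≤ n := (Real.toNNReal_le_iff_le_coe.1 hxc).trans hhn
  have hsn : (s : ℝ) + 1 ≤ n := le_trans (by exact_mod_cast hxs) hhn
  have hnode : ∀ m ≤ n, nodeValue (fun n => f n) m ≤ S := by
    intro m hm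
    unfold nodeValue
    split_ifs with hm0
    · exact_mod_cast Finset.single_le_sum (f := f) (fun _ _ => Nat.zero_le _)
        (Finset.mem_range.2 (Nat.lt_succ_of_le hm))
    · positivity
  have hxS : (x : ℝ) ≤ n * S := by
    refine hx.trans ?_
    have h1 := linearInterpolation_le (hnode _ (Nat.le_succ _)) (hnode (⌊h x⌋₊ + 1) le_rfl)
    exact mul_le_mul hcn h1 (linearInterpolation_nonneg _ _) (Nat.cast_nonneg _)
  have hfloor : ⌊x⌋₊ ≤ n * S := Nat.floor_le_of_le (by exact_mod_cast hxS)
  have hgn : g ⟨⌊x⌋₊ + 1, Nat.succ_pos _⟩ ≤ n + 1 := by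
    refine hs n _ (Nat.succ_pos _) ?_
    have : s + 1 ≤ n := by exact_mod_cast hsn
    simp only [PNat.mk_coe, iterationExponent, ← hS]
    omega
  have hnode' : nodeValue g (⌊x⌋₊ + 1) ≤ n + 1 :=
    (nodeValue_coe g ⟨⌊x⌋₊ + 1, Nat.succ_pos _⟩).trans_le (by exact_mod_cast hgn)
  have h1 : linearInterpolation g x ≤ n + 1 :=
    linearInterpolation_le ((nodeValue_monotone hg (Nat.le_succ _)).trans hnode') hnode'
  have h2 : (x : ℝ) / (1 + x) ≤ 1 := by exact_mod_cast (div_one_add_lt_one x).le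
  have h3 : (1 : ℝ) ≤ h x := by
    have : (s : ℝ) + 1 ≤ h x := by exact_mod_cast hxs
    linarith [s.cast_nonneg (α := ℝ)]
  rw [coe_strictInterpolation]
  linarith

theorem mainTheorem4 (f : ℕ → ℕ) (hf : Computable f)
    (hω : (fun _ : ℕ => (1 : ℝ)) =o[atTop] (fun n => (f n : ℝ))) :
    ∃ M : MultiwaySystem, M.IsUnbounded ∧ M.IsRegular ∧
      ∃ a b : ℝ≥0 → ℝ≥0, Function.Bijective a ∧ Function.Bijective b ∧
        IsTightBounds M.growth a b ∧
        (∃ h, IsAsymptoticInverse f h ∧ InBigO a h ∧ InBigO b h) ∧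
        (∀ h, IsAsymptoticInverse f h → Tendsto h atTop atTop → InBigO a h ∧ InBigO b h) := by
  have hf' : Tendsto f atTop atTop := by
    simpa [isLittleO_one_left_iff, tendsto_natCast_atTop_iff] using hω
  have he : ∀ n, n ≤ iterationExponent f n := fun n => Nat.le_add_left _ _
  have he' := iterationExponent_monotone f
  let φ : ℕ → ℕ := fun x => 2 ^ iterationExponent f (x + 1)
  have hφ : Computable φ :=
    computable_two_pow.comp ((computable_iterationExponent hf).comp Computable.succ)
  obtain ⟨M, hmono, hone, htop, s, hs⟩ :=
    MultiwaySystem.exists_slow_growth hφ (le_iterate_of_two_pow he fun _ => rfl)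
  have hunb : M.IsUnbounded := by
    have hfin : ¬ M.IsFinite := fun ⟨n, hn⟩ => (Nat.lt_of_lt_of_le one_pos (hone n)).ne' hn
    refine ⟨hfin, fun ⟨⟨b, hb⟩, _⟩ => ?_⟩
    obtain ⟨n, hn⟩ := htop (b + 1)
    exact (hn.trans (hb n)).not_gt b.lt_succ_self
  have hnode : Tendsto (nodeValue M.growth) atTop atTop := by
    refine tendsto_atTop_atTop_of_monotone (nodeValue_monotone hmono) fun b => ?_
    obtain ⟨n, hn⟩ := htop ⌈b⌉₊
    refine ⟨n, ?_⟩
    rw [nodeValue_coe]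
    exact (Nat.le_ceil b).trans (by exact_mod_cast hn)
  have hup := upperSeq_eq hmono
  have hlow := lowerSeq_eq hmono hone
  have hall : ∀ h, IsAsymptoticInverse f h → Tendsto h atTop atTop →
      InBigO (strictInterpolation M.growth) h ∧ InBigO (strictInterpolation M.growth) h := by
    intro h hh hh'
    have := inBigO_strictInterpolation hmono (s := s) (fun k n hk hn => hs k n
      ((Nat.pow_le_pow_right two_pos hn).trans
        (two_pow_le_iterate he he' (fun _ => rfl) hk))) hh hh'
    exact ⟨this, this⟩
  have hbij := strictInterpolation_bijective hmono hnode
  have hcont := continuous_strictInterpolation M.growth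
  have htheta := strictInterpolation_isTheta hnode
  refine ⟨M, hunb, ⟨hunb, fun a b hab => ?_⟩, strictInterpolation M.growth,
    strictInterpolation M.growth, hbij, hbij, ⟨hcont, hcont, ?_, ?_⟩, ?_, hall⟩
  · obtain ⟨-, -, ha, hb⟩ := hab
    rw [hup] at ha
    rw [hlow] at hb
    exact ha.trans hb.symm
  · rwa [hup]
  · rwa [hlow]
  · obtain ⟨h, hh, hh'⟩ := exists_isAsymptoticInverse hf'
    exact ⟨h, hh, hall h hh hh'⟩
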